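/- There is an absolute constant $K>0$ such that the following holds for all integers $n,t\ge 0$ and every pure $n$-qubit state $|\psi\rangle=\sum_{x\in\{0,1\}^n}c_x|x\rangle$ with $\sum_x|c_x|^2=1$. Let $\mathcal{E}_{\mathrm{coh.}}(\psi)$ be the ensemble of the states $PF|\psi\rangle$, where $P=\sum_x|p(x)\rangle\langle x|$ for a uniformly random permutation $p$ of $\{0,1\}^n$ and, independently, $F=\sum_x e^{2\pi i f(x)}|x\rangle\langle x|$ with the $f(x)$ independent and uniform in $[0,1)$. Let $\mathcal{C}_2(\psi)=-\log\sum_x|c_x|^4$ be the second Rényi coherence of $\psi$ (the second Rényi entropy of the distribution $(|c_x|^2)_x$). Then $\mathcal{E}_{\mathrm{coh.}}(\psi)$ is an approximate state $t$-design with error $K\,t^2e^{-\mathcal{C}_2(\psi)}$, that is, $$\tfrac12\Big\|\,\mathbb{E}_{\phi\sim\mathcal{E}_{\mathrm{coh.}}(\psi)}\big[(|\phi\rangle\langle\phi|)^{\otimes t}\big]-\mathbb{E}_{\phi\sim\mathrm{Haar}}\big[(|\phi\rangle\langle\phi|)^{\otimes t}\big]\Big\|_1\le K\,t^2e^{-\mathcal{C}_2(\psi)},$$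 where $\|\cdot\|_1$ is the trace norm and a Haar random state is $U|0\cdots0\rangle$ for a Haar random unitary $U$ on the $n$ qubits. -/

import Mathlib

open MeasureTheory

noncomputable section

/-! Vectors are functions `X → ℂ` of amplitudes in the computational basis, which is labelled by a
finite type `X`; operators are matrices. For `n` qubits `X` is the type of bit strings. -/

/-- The labels of the computational basis of `n` qubits: bit strings of length `n`. -/
abbrev Bits (n : ℕ) : Type := Fin n → Fin 2

/-- The operator `|φ⟩⟨φ|`. -/
def ketbra {X : Type*} (φ : X → ℂ) : Matrix X X ℂ :=
  Matrix.vecMulVec φ (star φ)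

/-- The tensor power `A^{⊗t}`, whose rows and columns are labelled by `t`-tuples of labels. -/
def tensorPower {X : Type*} (t : ℕ) (A : Matrix X X ℂ) :
    Matrix (Fin t → X) (Fin t → X) ℂ :=
  Matrix.of fun x y => ∏ i, A (x i) (y i)

/-- The trace norm: the sum of the singular values. -/
def traceNorm {Y : Type*} [Fintype Y] [DecidableEq Y] (A : Matrix Y Y ℂ) : ℝ :=
  ∑ i, Real.sqrt ((Matrix.isHermitian_conjTranspose_mul_self A).eigenvalues i)

/-- The trace distance `TD(A, B) = ‖A - B‖₁ / 2`. -/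
def traceDist {Y : Type*} [Fintype Y] [DecidableEq Y] (A B : Matrix Y Y ℂ) : ℝ :=
  traceNorm (A - B) / 2

/-- The `t`-th moment `𝔼_{φ ∼ μ} [(|φ⟩⟨φ|)^{⊗t}]` of an ensemble of states, that is, of a probability
measure `μ` on vectors. -/
def stateMoment {X : Type*} (μ : Measure (X → ℂ)) (t : ℕ) :
    Matrix (Fin t → X) (Fin t → X) ℂ :=
  Matrix.of fun x y => ∫ φ, tensorPower t (ketbra φ) x y ∂μ

/-! ### Haar random states -/

instance unitaryGroupCompactSpace (X : Type*) [Fintype X] [DecidableEq X] :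
    CompactSpace (Matrix.unitaryGroup X ℂ) := by
  refine isCompact_iff_compactSpace.mp ?_
  have hK : IsCompact {A : X → X → ℂ | ∀ i, A i ∈ {r : X → ℂ | ∀ j, r j ∈
      Metric.closedBall (0 : ℂ) 1}} :=
    isCompact_pi_infinite fun _ => isCompact_pi_infinite fun _ => isCompact_closedBall 0 1
  refine IsCompact.of_isClosed_subset (t := (_ : Set (Matrix X X ℂ))) hK ?_ ?_
  · exact isClosed_unitary
  · intro U hU i j
    simpa using entry_norm_bound_of_unitary hU i j

instance unitaryGroupMeasurableSpace (X : Type*) [Fintype X] [DecidableEq X] :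
    MeasurableSpace (Matrix.unitaryGroup X ℂ) := borel _

instance unitaryGroupBorelSpace (X : Type*) [Fintype X] [DecidableEq X] :
    BorelSpace (Matrix.unitaryGroup X ℂ) := ⟨rfl⟩

/-- The Haar probability measure on the unitary group: the Haar measure that gives the whole
(compact) group mass one. -/
def haarUnitary (X : Type*) [Fintype X] [DecidableEq X] : Measure (Matrix.unitaryGroup X ℂ) :=
  Measure.haarMeasure ⊤

/-- The ensemble of Haar random `n`-qubit states: the law of `U |0…0⟩` for a Haar random unitary
`U`. -/
def haarStates (n : ℕ) : Measure (Bits n → ℂ) :=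
  (haarUnitary (Bits n)).map fun U : Matrix.unitaryGroup (Bits n) ℂ =>
    (U : Matrix (Bits n) (Bits n) ℂ).mulVec (Pi.single 0 1)

/-- An ensemble `μ` of `n`-qubit states is an approximate state `t`-design with error `ε` if its
`t`-th moment has trace distance at most `ε` from that of the Haar random states. -/
def IsApproxStateDesign {n : ℕ} (μ : Measure (Bits n → ℂ)) (t : ℕ) (ε : ℝ) : Prop :=
  traceDist (stateMoment μ t) (stateMoment (haarStates n) t) ≤ ε

/-! ### The constant coherence orbit -/

/-- The diagonal phase operator `F = ∑ₓ e^{2πi f(x)} |x⟩⟨x|`, for `f : X → ℝ/ℤ`. -/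
def phaseOp {X : Type*} [DecidableEq X] (f : X → UnitAddCircle) : Matrix X X ℂ :=
  Matrix.diagonal fun x => (AddCircle.toCircle (f x) : ℂ)

/-- The permutation operator `P = ∑ₓ |p(x)⟩⟨x|`. -/
def permOp {X : Type*} [DecidableEq X] (p : Equiv.Perm X) : Matrix X X ℂ :=
  Matrix.of fun y x => if y = p x then 1 else 0

/-- The ensemble of the states `P F |ψ⟩`, with a uniformly random permutation of the computational
basis and, independently, uniform independent phases. -/
def coherenceOrbit {X : Type*} [Fintype X] [DecidableEq X] (ψ : X → ℂ) : Measure (X → ℂ) :=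
  ∑ p : Equiv.Perm X, (Fintype.card (Equiv.Perm X) : ENNReal)⁻¹ •
    (Measure.pi fun _ : X => (AddCircle.haarAddCircle : Measure UnitAddCircle)).map
      fun f => (permOp p * phaseOp f).mulVec ψ

/-- The second Rényi entropy `-log ∑ₓ pₓ²`. -/
def renyiEntropyTwo {X : Type*} [Fintype X] (p : X → ℝ) : ℝ :=
  -Real.log (∑ x, p x ^ 2)

/-- The second Rényi coherence: the second Rényi entropy of the distribution `|cₓ|²` of
computational basis outcomes. -/
def renyiCoherenceTwo {X : Type*} [Fintype X] (ψ : X → ℂ) : ℝ :=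
  renyiEntropyTwo fun x => ‖ψ x‖ ^ 2

end

/-!
Multiplying the amplitudes of a random state by fixed phases multiplies the matrix element of the
`t`-th moment between tuples `x` and `y` of labels by the corresponding character. Both ensembles are
invariant under such phases, so both moments vanish unless `y` is a rearrangement of `x`, and are
constant on each block of rearrangements (`stateMoment_apply_eq_zero`,
`stateMoment_apply_eq_outcomeProb`). Such blocks are multiples of rank-one projections, so the trace
distance is the total variation distance between the two laws of the outcome of measuring `t` copies
in the computational basis (`traceDist_stateMoment`).

Both ensembles are also invariant under permutations of the labels, so under either law all tuples
without repetitions are equally likely. The two laws can therefore differ only through the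
probability of a repetition, which by the birthday bound is at most `t²` times the expectation of
`∑ₐ |φₐ|⁴` (`sum_abs_outcomeProb_sub_le`).

On the coherence orbit `∑ₐ |φₐ|⁴` is constant and equals `e^{-C₂}`. For Haar random states in dimension
`d` its expectation is `2 / (d + 1)`, by invariance under the rotations of two amplitudes
(`collisionProb_haarStates`); this is at most `2 e^{-C₂}`, because a distribution on `d` points has
collision probability at least `1 / d`.
-/

/-! ### Trace norm of matrices with constant blocks -/

section TraceNorm

open scoped ComplexOrder

/-- The trace norm of `A` is the trace of any positive semidefinite `B` with `B² = Aᴴ A`. -/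
theorem traceNorm_eq_trace {Y : Type*} [Fintype Y] [DecidableEq Y] {A B : Matrix Y Y ℂ}
    (hB : B.PosSemidef) (h : B ^ 2 = A.conjTranspose * A) : traceNorm A = B.trace.re := by
  have hA := Matrix.isHermitian_conjTranspose_mul_self A
  have h1 : (A.conjTranspose * A).charpoly.roots =
      Finset.univ.val.map fun i => ((hB.1.eigenvalues i ^ 2 : ℝ) : ℂ) := by
    have hc := hB.1.charpoly_cfc_eq (fun x : ℝ => x ^ 2)
    rw [cfc_pow_id B 2 hB.1.isSelfAdjoint, h] at hc
    rw [hc, Polynomial.roots_prod _ _ (Finset.prod_ne_zero_iff.mpr fun i _ =>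
      Polynomial.X_sub_C_ne_zero _)]
    simp only [Polynomial.roots_X_sub_C]
    exact Multiset.bind_singleton _ _
  rw [hA.roots_charpoly_eq_eigenvalues] at h1
  have h2 := congrArg (fun m : Multiset ℂ => (m.map fun z => Real.sqrt z.re).sum) h1
  simp only [Multiset.map_map, Function.comp_def, Complex.coe_algebraMap, Complex.ofReal_re,
    Real.sqrt_sq (hB.eigenvalues_nonneg _)] at h2
  rw [hB.1.trace_eq_sum_eigenvalues]
  simp only [Complex.re_sum]
  exact h2

/-- A matrix that vanishes off the blocks `f x = f y`, and is constant on each block, has trace norm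
the `ℓ¹` norm of its diagonal: each block is a multiple of a rank-one projection. -/
theorem traceNorm_of_constant_blocks {Y Z : Type*} [Fintype Y] [DecidableEq Y] [DecidableEq Z]
    (f : Y → Z) (w : Y → ℝ) (hw : ∀ x y, f x = f y → w x = w y) :
    traceNorm (Matrix.of fun x y => if f x = f y then (w x : ℂ) else 0) = ∑ x, |w x| := by
  classical
  -- a representative of each block, chosen as a function of `f x` alone
  let r : Y → Y := fun x => Classical.choose (⟨x, rfl⟩ : ∃ z : Y, f z = f x)
  have hrf : ∀ x, f (r x) = f x := fun x => Classical.choose_spec (⟨x, rfl⟩ : ∃ z : Y, f z = f x)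
  have hrr : ∀ x y, f x = f y ↔ r x = r y := fun x y =>
    ⟨fun h => by simp only [r, h], fun h => by rw [← hrf x, h, hrf y]⟩
  let G : Matrix Y Y ℂ := Matrix.of fun z x => if z = r x then 1 else 0
  let D : Matrix Y Y ℂ := Matrix.diagonal fun z => ((|w z| : ℝ) : ℂ)
  have hD : D.PosSemidef := Matrix.PosSemidef.diagonal fun z => by
    simp
  have hGD : G.conjTranspose * D * G =
      Matrix.of fun x y => if f x = f y then ((|w x| : ℝ) : ℂ) else 0 := by
    ext x y
    simp only [D]
    rw [Matrix.mul_apply]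
    simp only [Matrix.mul_diagonal, G, Matrix.conjTranspose_apply, Matrix.of_apply]
    rw [Finset.sum_eq_single (r y) (fun z _ hz => by simp [hz]) (by simp)]
    simp only [hrr x y, hw _ _ (hrf y), if_true, mul_one, eq_comm (a := r y)]
    split_ifs with h
    · rw [hw x y ((hrr x y).2 h)]
      simp
    · simp
  rw [traceNorm_eq_trace (hGD ▸ hD.conjTranspose_mul_mul_same G)]
  · simp [Matrix.trace]
  · ext x y
    rw [sq]
    simp only [Matrix.mul_apply, Matrix.conjTranspose_apply, Matrix.of_apply]
    refine Finset.sum_congr rfl fun z _ => ?_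
    by_cases hxz : f x = f z
    · by_cases hzy : f z = f y
      · simp only [hxz, hzy, if_true, hw x z hxz, Complex.star_def, Complex.conj_ofReal]
        rw [← Complex.ofReal_mul, ← Complex.ofReal_mul, abs_mul_abs_self]
      · simp [hzy]
    · simp [hxz, Ne.symm hxz]

end TraceNorm

/-! ### The birthday bound -/

section CollisionBound

variable {X : Type*} [Fintype X] [DecidableEq X]

/-- Two given entries of an independent sample from `p` agree with probability `∑ₐ pₐ²`. -/
theorem sum_prod_of_eq_entries {t : ℕ} (p : X → ℝ) (hp : ∑ a, p a = 1) {i j : Fin t}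
    (hij : i ≠ j) :
    ∑ x : Fin t → X, (if x i = x j then ∏ k, p (x k) else 0) = ∑ a, p a ^ 2 := by
  have h1 : ∀ x : Fin t → X, (if x i = x j then ∏ k, p (x k) else 0) =
      ∑ a, ∏ k, (if k = i ∨ k = j then (if x k = a then p (x k) else 0) else p (x k)) := by
    intro x
    have h2 : ∀ a, (∏ k, (if k = i ∨ k = j then (if x k = a then p (x k) else 0) else p (x k))) =
        if x i = a then (if x j = a then ∏ k, p (x k) else 0) else 0 := by
      intro a
      by_cases hi : x i = a
      · by_cases hj : x j = a
        · rw [if_pos hi, if_pos hj]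
          refine Finset.prod_congr rfl fun k _ => ?_
          split_ifs with hk hka
          · rfl
          · rcases hk with rfl | rfl <;> contradiction
          · rfl
        · rw [if_pos hi, if_neg hj]
          exact Finset.prod_eq_zero (Finset.mem_univ j) (by simp [hj])
      · rw [if_neg hi]
        exact Finset.prod_eq_zero (Finset.mem_univ i) (by simp [hi])
    simp only [h2, Finset.sum_ite_eq, Finset.mem_univ, if_true]
    simp only [eq_comm (a := x i)]
  simp only [h1]
  rw [Finset.sum_comm]
  refine Finset.sum_congr rfl fun a _ => ?_
  have h3 := Finset.prod_univ_sum (fun _ : Fin t => (Finset.univ : Finset X))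
    (fun k b => if k = i ∨ k = j then (if b = a then p b else 0) else p b)
  rw [Fintype.piFinset_univ] at h3
  rw [← h3]
  have h4 : ∀ k : Fin t, (∑ b, if k = i ∨ k = j then (if b = a then p b else 0) else p b) =
      if k ∈ ({i, j} : Finset (Fin t)) then p a else 1 := by
    intro k
    by_cases hk : k = i ∨ k = j <;> simp [hk, hp]
  simp only [h4]
  rw [Finset.prod_ite_mem, Finset.univ_inter, Finset.prod_const, Finset.card_pair hij]

/-- The birthday bound: an independent sample of size `t` from `p` has a repeated entry with
probability at most `t² ∑ₐ pₐ²`. -/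
theorem sum_not_injective_prod_le (t : ℕ) (p : X → ℝ) (hp0 : ∀ a, 0 ≤ p a)
    (hp : ∑ a, p a = 1) :
    ∑ x : Fin t → X with ¬ Function.Injective x, ∏ k, p (x k) ≤ t ^ 2 * ∑ a, p a ^ 2 := by
  have hprod : ∀ x : Fin t → X, 0 ≤ ∏ k, p (x k) := fun x =>
    Finset.prod_nonneg fun k _ => hp0 _
  calc ∑ x : Fin t → X with ¬ Function.Injective x, ∏ k, p (x k)
      ≤ ∑ x : Fin t → X, ∑ ij : Fin t × Fin t,
          if ij.1 = ij.2 then 0 else if x ij.1 = x ij.2 then ∏ k, p (x k) else 0 := by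
        rw [Finset.sum_filter]
        refine Finset.sum_le_sum fun x _ => ?_
        have hnn : ∀ ij ∈ (Finset.univ : Finset (Fin t × Fin t)), 0 ≤
            if ij.1 = ij.2 then 0 else if x ij.1 = x ij.2 then ∏ k, p (x k) else 0 := by
          intro ij _
          split_ifs
          · exact le_rfl
          · exact hprod x
          · exact le_rfl
        by_cases hx : Function.Injective x
        · rw [if_neg (not_not.2 hx)]
          exact Finset.sum_nonneg hnn
        · rw [if_pos hx]
          simp only [Function.Injective, not_forall] at hx
          obtain ⟨i, j, hxij, hij⟩ := hx
          refine le_trans ?_ (Finset.single_le_sum hnn (Finset.mem_univ (i, j)))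
          simp [hxij, hij]
    _ = ∑ ij : Fin t × Fin t, if ij.1 = ij.2 then 0 else ∑ a, p a ^ 2 := by
        rw [Finset.sum_comm]
        refine Finset.sum_congr rfl fun ij _ => ?_
        split_ifs with h
        · simp
        · exact sum_prod_of_eq_entries p hp h
    _ ≤ ∑ ij : Fin t × Fin t, ∑ a, p a ^ 2 := by
        refine Finset.sum_le_sum fun ij _ => ?_
        split_ifs
        · exact Finset.sum_nonneg fun a _ => sq_nonneg _
        · exact le_rfl
    _ = t ^ 2 * ∑ a, p a ^ 2 := by simp [sq]

end CollisionBound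

/-! ### Symmetric ensembles and their outcome distributions -/

/-- A probability measure on unit vectors whose law does not change when the amplitudes are
multiplied by fixed phases or permuted. -/
structure IsSymmetricEnsemble {X : Type*} [Fintype X] (μ : Measure (X → ℂ)) : Prop where
  isProbabilityMeasure : IsProbabilityMeasure μ
  normalized : ∀ᵐ φ ∂μ, ∑ x, ‖φ x‖ ^ 2 = 1
  phase : ∀ u : X → Circle, MeasurePreserving (fun (φ : X → ℂ) x => (u x : ℂ) * φ x) μ μ
  perm : ∀ p : Equiv.Perm X, MeasurePreserving (fun (φ : X → ℂ) x => φ (p x)) μ μ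

/-- The probability of the outcomes `x` when `t` copies of a random state are measured in the
computational basis. -/
noncomputable def outcomeProb {X : Type*} (μ : Measure (X → ℂ)) {t : ℕ} (x : Fin t → X) : ℝ :=
  ∫ φ, ∏ i, ‖φ (x i)‖ ^ 2 ∂μ

theorem outcomeProb_nonneg {X : Type*} (μ : Measure (X → ℂ)) {t : ℕ} (x : Fin t → X) :
    0 ≤ outcomeProb μ x :=
  integral_nonneg fun _ => Finset.prod_nonneg fun _ _ => sq_nonneg _

/-- The expected probability that measuring two copies in the computational basis gives the same
outcome. -/
noncomputable def collisionProb {X : Type*} [Fintype X] (μ : Measure (X → ℂ)) : ℝ :=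
  ∫ φ, ∑ a, (‖φ a‖ ^ 2) ^ 2 ∂μ

namespace IsSymmetricEnsemble

variable {X : Type*} [Fintype X] {μ ν : Measure (X → ℂ)}

/-- A continuous function of a random unit vector is integrable, since the sphere is compact. -/
theorem integrable_of_continuous {E : Type*} [NormedAddCommGroup E] [SecondCountableTopology E]
    (hμ : IsSymmetricEnsemble μ) {g : (X → ℂ) → E} (hg : Continuous g) : Integrable g μ := by
  have := hμ.isProbabilityMeasure
  borelize E
  obtain ⟨C, hC⟩ := (isCompact_closedBall (0 : X → ℂ) 1).exists_bound_of_continuousOn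
    hg.continuousOn
  refine Integrable.of_bound hg.measurable.aestronglyMeasurable C ?_
  filter_upwards [hμ.normalized] with φ hφ
  refine hC φ ?_
  rw [mem_closedBall_zero_iff, pi_norm_le_iff_of_nonneg zero_le_one]
  intro x
  have := Finset.single_le_sum (fun a _ => sq_nonneg ‖φ a‖) (Finset.mem_univ x)
  rw [hφ] at this
  nlinarith [norm_nonneg (φ x)]

theorem integral_phase {E : Type*} [NormedAddCommGroup E] [NormedSpace ℝ E]
    [SecondCountableTopology E]
    (hμ : IsSymmetricEnsemble μ) {g : (X → ℂ) → E} (hg : Continuous g) (u : X → Circle) :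
    ∫ φ, g (fun x => (u x : ℂ) * φ x) ∂μ = ∫ φ, g φ ∂μ := by
  borelize E
  have h := integral_map (μ := μ) (hμ.phase u).measurable.aemeasurable
    (f := g) hg.measurable.aestronglyMeasurable
  rw [(hμ.phase u).map_eq] at h
  exact h.symm

theorem outcomeProb_perm (hμ : IsSymmetricEnsemble μ) {t : ℕ} (x : Fin t → X)
    (p : Equiv.Perm X) : outcomeProb μ (fun i => p (x i)) = outcomeProb μ x := by
  have hg : Continuous fun φ : X → ℂ => ∏ i, ‖φ (x i)‖ ^ 2 := by fun_prop
  have h := integral_map (μ := μ) (hμ.perm p).measurable.aemeasurable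
    (f := fun φ : X → ℂ => ∏ i, ‖φ (x i)‖ ^ 2) hg.measurable.aestronglyMeasurable
  rw [(hμ.perm p).map_eq] at h
  exact h.symm

theorem sum_outcomeProb (hμ : IsSymmetricEnsemble μ) (t : ℕ) :
    ∑ x : Fin t → X, outcomeProb μ x = 1 := by
  have := hμ.isProbabilityMeasure
  unfold outcomeProb
  rw [← integral_finsetSum _ fun x _ => hμ.integrable_of_continuous (by fun_prop)]
  have h : (fun φ : X → ℂ => ∑ x : Fin t → X, ∏ i, ‖φ (x i)‖ ^ 2) =ᵐ[μ] fun _ => (1 : ℝ) := by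
    filter_upwards [hμ.normalized] with φ hφ
    have h3 := Finset.prod_univ_sum (fun _ : Fin t => (Finset.univ : Finset X))
      (fun _ b => ‖φ b‖ ^ 2)
    rw [Fintype.piFinset_univ] at h3
    rw [← h3, hφ, Finset.prod_const_one]
  rw [integral_congr_ae h]
  simp

theorem sum_not_injective_outcomeProb_le [DecidableEq X] (hμ : IsSymmetricEnsemble μ) (t : ℕ) :
    ∑ x : Fin t → X with ¬ Function.Injective x, outcomeProb μ x ≤
      t ^ 2 * collisionProb μ := by
  unfold outcomeProb collisionProb
  rw [← integral_finsetSum _ fun x _ => hμ.integrable_of_continuous (by fun_prop),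
    ← integral_const_mul]
  refine integral_mono_ae (hμ.integrable_of_continuous (by fun_prop))
    (hμ.integrable_of_continuous (by fun_prop)) ?_
  filter_upwards [hμ.normalized] with φ hφ
  exact sum_not_injective_prod_le t _ (fun a => sq_nonneg _) hφ

/-- The outcome probabilities of two symmetric ensembles differ by a constant on the tuples
without repetitions, which are all equally likely; so the two distributions can differ only through
the probabilities of a repetition. -/
theorem sum_abs_outcomeProb_sub_le [DecidableEq X]
    (hμ : IsSymmetricEnsemble μ) (hν : IsSymmetricEnsemble ν)
    (t : ℕ) : ∑ x : Fin t → X, |outcomeProb μ x - outcomeProb ν x| ≤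
      2 * (t ^ 2 * (collisionProb μ + collisionProb ν)) := by
  have hconst : ∀ x y : Fin t → X, Function.Injective x → Function.Injective y →
      outcomeProb μ x - outcomeProb ν x = outcomeProb μ y - outcomeProb ν y := by
    intro x y hx hy
    obtain ⟨p, hp⟩ := (Equiv.Perm.isMultiplyPretransitive X t).exists_smul_eq ⟨x, hx⟩ ⟨y, hy⟩
    have hp' : (fun i => p (x i)) = y := by
      funext i
      exact congrArg (fun e : Fin t ↪ X => e i) hp
    rw [← hp', hμ.outcomeProb_perm, hν.outcomeProb_perm]
  have hcoll : ∑ x : Fin t → X with ¬ Function.Injective x,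
      |outcomeProb μ x - outcomeProb ν x| ≤ t ^ 2 * (collisionProb μ + collisionProb ν) := by
    calc _ ≤ ∑ x : Fin t → X with ¬ Function.Injective x,
          (outcomeProb μ x + outcomeProb ν x) := by
          refine Finset.sum_le_sum fun x _ => ?_
          rw [abs_le]
          constructor <;> linarith [outcomeProb_nonneg μ x, outcomeProb_nonneg ν x]
      _ ≤ _ := by
          rw [Finset.sum_add_distrib, mul_add]
          exact add_le_add (hμ.sum_not_injective_outcomeProb_le t)
            (hν.sum_not_injective_outcomeProb_le t)
  have hinj : ∑ x : Fin t → X with Function.Injective x, |outcomeProb μ x - outcomeProb ν x| ≤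
      ∑ x : Fin t → X with ¬ Function.Injective x, |outcomeProb μ x - outcomeProb ν x| := by
    have habs : ∑ x : Fin t → X with Function.Injective x, |outcomeProb μ x - outcomeProb ν x| =
        |∑ x : Fin t → X with Function.Injective x, (outcomeProb μ x - outcomeProb ν x)| := by
      rcases (Finset.univ.filter fun x : Fin t → X => Function.Injective x).eq_empty_or_nonempty
        with he | ⟨x₀, hx₀⟩
      · simp [he]
      · have hc : ∀ x ∈ Finset.univ.filter (fun x : Fin t → X => Function.Injective x),
            outcomeProb μ x - outcomeProb ν x = outcomeProb μ x₀ - outcomeProb ν x₀ :=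
          fun x hx => hconst x x₀ (Finset.mem_filter.1 hx).2 (Finset.mem_filter.1 hx₀).2
        rw [Finset.sum_congr rfl hc, Finset.sum_congr rfl fun x hx => congrArg abs (hc x hx)]
        rw [Finset.sum_const, Finset.sum_const, nsmul_eq_mul, nsmul_eq_mul, abs_mul, Nat.abs_cast]
    have htot := Finset.sum_filter_add_sum_filter_not Finset.univ
      (fun x : Fin t → X => Function.Injective x) fun x => outcomeProb μ x - outcomeProb ν x
    rw [Finset.sum_sub_distrib (s := Finset.univ), hμ.sum_outcomeProb, hν.sum_outcomeProb,
      sub_self] at htot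
    rw [habs, eq_neg_of_add_eq_zero_left htot, abs_neg]
    exact Finset.abs_sum_le_sum_abs _ _
  rw [← Finset.sum_filter_add_sum_filter_not Finset.univ
    (fun x : Fin t → X => Function.Injective x)]
  linarith

end IsSymmetricEnsemble

/-! ### Moments of symmetric ensembles -/

theorem tensorPower_ketbra_apply {X : Type*} {t : ℕ} (φ : X → ℂ) (x y : Fin t → X) :
    tensorPower t (ketbra φ) x y = (∏ i, φ (x i)) * ∏ i, star (φ (y i)) := by
  simp [tensorPower, ketbra, Matrix.vecMulVec_apply, Finset.prod_mul_distrib]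

theorem stateMoment_apply_eq_outcomeProb {X : Type*} (μ : Measure (X → ℂ)) {t : ℕ}
    {x y : Fin t → X} (h : Finset.univ.val.map x = Finset.univ.val.map y) :
    stateMoment μ t x y = (outcomeProb μ x : ℂ) := by
  unfold stateMoment outcomeProb
  rw [Matrix.of_apply, ← integral_complex_ofReal]
  refine integral_congr_ae (.of_forall fun φ => ?_)
  have h1 : ∏ i, star (φ (y i)) = ∏ i, star (φ (x i)) := by
    have h2 := congrArg (fun m : Multiset X => (m.map fun b => star (φ b)).prod) h
    simp only [Multiset.map_map] at h2
    exact h2.symm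
  simp only [tensorPower_ketbra_apply, h1, ← Finset.prod_mul_distrib, Complex.ofReal_prod]
  refine Finset.prod_congr rfl fun i _ => ?_
  rw [Complex.star_def, Complex.mul_conj']
  push_cast
  rfl

namespace IsSymmetricEnsemble

variable {X : Type*} {μ ν : Measure (X → ℂ)}

/-- Matrix elements of the moment between tuples that are not rearrangements of each other vanish:
some label `a` occurs `k` times in `x` and `l ≠ k` times in `y`, and the phase `e^{iπ/(k-l)}` on the
amplitude of `a` changes the sign of the integrand. -/
theorem stateMoment_apply_eq_zero [Fintype X] [DecidableEq X] (hμ : IsSymmetricEnsemble μ) {t : ℕ}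
    {x y : Fin t → X} (h : Finset.univ.val.map x ≠ Finset.univ.val.map y) :
    stateMoment μ t x y = 0 := by
  obtain ⟨a, ha⟩ : ∃ a, (Finset.univ.filter fun i => x i = a).card ≠
      (Finset.univ.filter fun i => y i = a).card := by
    by_contra! hc
    refine h (Multiset.ext.2 fun a => ?_)
    simpa only [Multiset.count_map, Finset.card_def, Finset.filter_val, eq_comm] using hc a
  set k := (Finset.univ.filter fun i => x i = a).card
  set l := (Finset.univ.filter fun i => y i = a).card
  have hkl : ((k : ℝ) - l) ≠ 0 := sub_ne_zero.2 (by exact_mod_cast ha)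
  let z : Circle := Circle.exp (Real.pi / (k - l))
  have hz : (z : ℂ) ^ k * (star (z : ℂ)) ^ l = -1 := by
    have h1 : star (z : ℂ) = ((z⁻¹ : Circle) : ℂ) := (Circle.coe_inv_eq_conj z).symm
    have h2 : z⁻¹ = Circle.exp (-(Real.pi / (k - l))) := (Circle.exp_neg _).symm
    rw [h1, h2, ← Circle.coe_pow, ← Circle.coe_pow, ← Circle.coe_mul, ← Circle.exp_nsmul,
      ← Circle.exp_nsmul, ← Circle.exp_add]
    have h3 : k • (Real.pi / ((k : ℝ) - l)) + l • (-(Real.pi / ((k : ℝ) - l))) = Real.pi := by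
      simp only [nsmul_eq_mul]
      field_simp
      ring
    rw [h3]
    simp [Circle.coe_exp]
  have hg : Continuous fun φ : X → ℂ => tensorPower t (ketbra φ) x y := by
    simp only [tensorPower_ketbra_apply]
    fun_prop
  have hint := hμ.integral_phase hg fun b => if b = a then z else 1
  have hprod : ∀ w : Fin t → X, ∏ i, (((if w i = a then z else 1 : Circle)) : ℂ) =
      (z : ℂ) ^ (Finset.univ.filter fun i => w i = a).card := by
    intro w
    rw [← Finset.prod_const, Finset.prod_filter]
    exact Finset.prod_congr rfl fun i _ => by split_ifs <;> simp
  have hsign : ∀ φ : X → ℂ, tensorPower t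
      (ketbra fun b => ((if b = a then z else 1 : Circle) : ℂ) * φ b) x y =
      -tensorPower t (ketbra φ) x y := by
    intro φ
    have hstar : ∏ i, star (((if y i = a then z else 1 : Circle)) : ℂ) = star (z : ℂ) ^ l := by
      rw [← star_prod, hprod, star_pow]
    simp only [tensorPower_ketbra_apply, star_mul', Finset.prod_mul_distrib]
    rw [hprod, hstar, mul_mul_mul_comm, hz]
    ring
  simp only [hsign, integral_neg] at hint
  exact self_eq_neg.1 hint.symm

/-- Since both moments are constant on the blocks of rearrangements of a tuple and vanish off these
blocks, their distance is the total variation distance of the outcome distributions. -/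
theorem traceDist_stateMoment [Fintype X] [DecidableEq X] (hμ : IsSymmetricEnsemble μ)
    (hν : IsSymmetricEnsemble ν) (t : ℕ) :
    traceDist (stateMoment μ t) (stateMoment ν t) =
      (∑ x : Fin t → X, |outcomeProb μ x - outcomeProb ν x|) / 2 := by
  have hblock : stateMoment μ t - stateMoment ν t =
      Matrix.of fun x y => if Finset.univ.val.map x = Finset.univ.val.map y then
        ((outcomeProb μ x - outcomeProb ν x : ℝ) : ℂ) else 0 := by
    ext x y
    rw [Matrix.sub_apply, Matrix.of_apply]
    split_ifs with h
    · rw [stateMoment_apply_eq_outcomeProb μ h, stateMoment_apply_eq_outcomeProb ν h,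
        Complex.ofReal_sub]
    · rw [hμ.stateMoment_apply_eq_zero h, hν.stateMoment_apply_eq_zero h, sub_zero]
  have hprob : ∀ (κ : Measure (X → ℂ)) (x y : Fin t → X),
      Finset.univ.val.map x = Finset.univ.val.map y → outcomeProb κ x = outcomeProb κ y := by
    intro κ x y h
    unfold outcomeProb
    congr 1
    funext φ
    have h2 := congrArg (fun m : Multiset X => (m.map fun b => ‖φ b‖ ^ 2).prod) h
    simp only [Multiset.map_map] at h2
    exact h2
  rw [traceDist, hblock, traceNorm_of_constant_blocks]
  intro x y h
  rw [hprob μ x y h, hprob ν x y h]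

theorem traceDist_stateMoment_le [Fintype X] [DecidableEq X] (hμ : IsSymmetricEnsemble μ)
    (hν : IsSymmetricEnsemble ν) (t : ℕ) :
    traceDist (stateMoment μ t) (stateMoment ν t) ≤
      t ^ 2 * (collisionProb μ + collisionProb ν) := by
  rw [hμ.traceDist_stateMoment hν]
  linarith [hμ.sum_abs_outcomeProb_sub_le hν t]

end IsSymmetricEnsemble

/-! ### The coherence orbit -/

section Orbit

variable {X : Type*} [Fintype X] [DecidableEq X]

theorem permOp_mul_phaseOp_mulVec (p : Equiv.Perm X) (f : X → UnitAddCircle) (ψ : X → ℂ) :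
    (permOp p * phaseOp f).mulVec ψ =
      fun y => (AddCircle.toCircle (f (p.symm y)) : ℂ) * ψ (p.symm y) := by
  funext y
  rw [← Matrix.mulVec_mulVec]
  simp only [permOp, phaseOp, Matrix.mulVec, dotProduct, Matrix.of_apply]
  rw [Finset.sum_eq_single (p.symm y)]
  · simp [Matrix.diagonal_apply]
  · intro x _ hx
    rw [if_neg, zero_mul]
    rintro rfl
    simp at hx
  · simp

theorem continuous_permOp_mul_phaseOp_mulVec (p : Equiv.Perm X) (ψ : X → ℂ) :
    Continuous fun f : X → UnitAddCircle => (permOp p * phaseOp f).mulVec ψ := by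
  simp only [permOp_mul_phaseOp_mulVec]
  refine continuous_pi fun y => ?_
  have := (AddCircle.continuous_toCircle (T := 1))
  fun_prop

theorem coherenceOrbit_apply (ψ : X → ℂ) {s : Set (X → ℂ)} (hs : MeasurableSet s) :
    coherenceOrbit ψ s = ∑ p : Equiv.Perm X, (Fintype.card (Equiv.Perm X) : ENNReal)⁻¹ *
      (Measure.pi fun _ : X => (AddCircle.haarAddCircle : Measure UnitAddCircle))
        {f | (permOp p * phaseOp f).mulVec ψ ∈ s} := by
  rw [coherenceOrbit, Measure.finsetSum_apply]
  refine Finset.sum_congr rfl fun p _ => ?_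
  rw [Measure.smul_apply, Measure.map_apply
    (continuous_permOp_mul_phaseOp_mulVec p ψ).measurable hs]
  rfl

theorem ae_coherenceOrbit {ψ : X → ℂ} {P : (X → ℂ) → Prop} (hP : MeasurableSet {φ | P φ})
    (h : ∀ (p : Equiv.Perm X) (f : X → UnitAddCircle), P ((permOp p * phaseOp f).mulVec ψ)) :
    ∀ᵐ φ ∂coherenceOrbit ψ, P φ := by
  rw [ae_iff, ← Set.compl_ofPred, coherenceOrbit_apply ψ hP.compl]
  simp [h]

theorem sum_norm_permOp_mul_phaseOp_mulVec (p : Equiv.Perm X) (f : X → UnitAddCircle)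
    (ψ : X → ℂ) (g : ℝ → ℝ) :
    ∑ y, g ‖(permOp p * phaseOp f).mulVec ψ y‖ = ∑ x, g ‖ψ x‖ := by
  rw [permOp_mul_phaseOp_mulVec]
  simp only [norm_mul, Circle.norm_coe, one_mul]
  exact Equiv.sum_comp p.symm fun x => g ‖ψ x‖

/-- Multiplying `P F |ψ⟩` by phases translates the phases in `F`, and permuting its amplitudes
translates the permutation in `P`. -/
theorem isSymmetricEnsemble_coherenceOrbit {ψ : X → ℂ} (hψ : ∑ x, ‖ψ x‖ ^ 2 = 1) :
    IsSymmetricEnsemble (coherenceOrbit ψ) where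
  isProbabilityMeasure := by
    constructor
    rw [coherenceOrbit_apply ψ MeasurableSet.univ]
    simp only [Set.mem_univ, Set.ofPred_true, measure_univ, mul_one, Finset.sum_const,
      Finset.card_univ, nsmul_eq_mul]
    exact ENNReal.mul_inv_cancel (by simp [Fintype.card_ne_zero]) (by simp)
  normalized := by
    refine ae_coherenceOrbit (IsClosed.measurableSet (isClosed_eq (by fun_prop) (by fun_prop)))
      fun p f => ?_
    rw [sum_norm_permOp_mul_phaseOp_mulVec p f ψ fun r => r ^ 2, hψ]
  phase u := by
    have hm : Measurable fun (φ : X → ℂ) x => (u x : ℂ) * φ x :=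
      Continuous.measurable (by fun_prop)
    refine ⟨hm, Measure.ext fun s hs => ?_⟩
    rw [Measure.map_apply hm hs, coherenceOrbit_apply ψ hs, coherenceOrbit_apply ψ (hm hs)]
    refine Finset.sum_congr rfl fun p _ => ?_
    congr 1
    choose v hv using fun x => (AddCircle.homeomorphCircle (T := 1) one_ne_zero).surjective (u x)
    refine Eq.trans ?_ (measure_preimage_add _ (fun x => v (p x)) _)
    congr 1
    ext f
    simp only [Set.mem_preimage, Set.mem_ofPred_eq, permOp_mul_phaseOp_mulVec, Pi.add_apply,
      Equiv.apply_symm_apply, AddCircle.toCircle_add, Circle.coe_mul, mul_assoc]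
    simp only [← hv, AddCircle.homeomorphCircle_apply]
  perm q := by
    have hm : Measurable fun (φ : X → ℂ) x => φ (q x) := Continuous.measurable (by fun_prop)
    refine ⟨hm, Measure.ext fun s hs => ?_⟩
    rw [Measure.map_apply hm hs, coherenceOrbit_apply ψ hs, coherenceOrbit_apply ψ (hm hs),
      ← Equiv.sum_comp (Equiv.mulLeft q)]
    refine Finset.sum_congr rfl fun p _ => ?_
    congr 2
    ext f
    simp only [Set.mem_preimage, Set.mem_ofPred_eq, permOp_mul_phaseOp_mulVec, Equiv.coe_mulLeft,
      Equiv.Perm.mul_def, Equiv.symm_trans_apply, Equiv.symm_apply_apply]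

theorem collisionProb_coherenceOrbit {ψ : X → ℂ} (hψ : ∑ x, ‖ψ x‖ ^ 2 = 1) :
    collisionProb (coherenceOrbit ψ) = ∑ x, (‖ψ x‖ ^ 2) ^ 2 := by
  have := (isSymmetricEnsemble_coherenceOrbit hψ).isProbabilityMeasure
  have h : ∀ᵐ φ ∂coherenceOrbit ψ, ∑ x, (‖φ x‖ ^ 2) ^ 2 = ∑ x, (‖ψ x‖ ^ 2) ^ 2 :=
    ae_coherenceOrbit (IsClosed.measurableSet (isClosed_eq (by fun_prop) (by fun_prop)))
      fun p f => sum_norm_permOp_mul_phaseOp_mulVec p f ψ fun r => (r ^ 2) ^ 2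
  rw [collisionProb, integral_congr_ae h]
  simp

end Orbit

/-! ### Haar random states -/

section Haar

theorem measurable_mulVec {X : Type*} [Fintype X] (M : Matrix X X ℂ) :
    Measurable fun φ : X → ℂ => M.mulVec φ :=
  Continuous.measurable (Continuous.matrix_mulVec continuous_const continuous_id)

theorem sum_norm_sq_mulVec {X : Type*} [Fintype X] [DecidableEq X]
    (U : Matrix.unitaryGroup X ℂ) (φ : X → ℂ) :
    ∑ x, ‖(U : Matrix X X ℂ).mulVec φ x‖ ^ 2 = ∑ x, ‖φ x‖ ^ 2 := by
  have hsum : ∀ v : X → ℂ, ((∑ x, ‖v x‖ ^ 2 : ℝ) : ℂ) = dotProduct (star v) v := by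
    intro v
    simp [dotProduct, Complex.conj_mul']
  apply Complex.ofReal_injective
  rw [hsum, hsum, Matrix.star_mulVec, Matrix.dotProduct_mulVec, Matrix.vecMul_vecMul,
    ← Matrix.star_eq_conjTranspose, Matrix.UnitaryGroup.star_mul_self, Matrix.vecMul_one]

theorem continuous_unitary_mulVec {X : Type*} [Fintype X] [DecidableEq X] (v : X → ℂ) :
    Continuous fun U : Matrix.unitaryGroup X ℂ => (U : Matrix X X ℂ).mulVec v :=
  Continuous.matrix_mulVec continuous_subtype_val continuous_const

instance isProbabilityMeasure_haarUnitary (X : Type*) [Fintype X] [DecidableEq X] :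
    IsProbabilityMeasure (haarUnitary X) :=
  ⟨Measure.haarMeasure_self (K₀ := ⊤)⟩

instance isMulLeftInvariant_haarUnitary (X : Type*) [Fintype X] [DecidableEq X] :
    (haarUnitary X).IsMulLeftInvariant := by
  unfold haarUnitary
  infer_instance

variable {n : ℕ}

theorem measurePreserving_mulVec_haarStates (U : Matrix.unitaryGroup (Bits n) ℂ) :
    MeasurePreserving (fun φ : Bits n → ℂ => (U : Matrix (Bits n) (Bits n) ℂ).mulVec φ)
      (haarStates n) (haarStates n) := by
  refine ⟨measurable_mulVec _, ?_⟩
  have hm := (continuous_unitary_mulVec (Pi.single (0 : Bits n) (1 : ℂ))).measurable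
  rw [haarStates, Measure.map_map (measurable_mulVec _) hm]
  conv_rhs => rw [← map_mul_left_eq_self (haarUnitary (Bits n)) U,
    Measure.map_map hm (continuous_const_mul U).measurable]
  congr 1
  funext V
  exact Matrix.mulVec_mulVec _ _ _

theorem isSymmetricEnsemble_haarStates (n : ℕ) : IsSymmetricEnsemble (haarStates n) where
  isProbabilityMeasure := Measure.isProbabilityMeasure_map
    (continuous_unitary_mulVec _).measurable.aemeasurable
  normalized := by
    rw [haarStates, ae_map_iff (continuous_unitary_mulVec _).measurable.aemeasurable
      (IsClosed.measurableSet (isClosed_eq (by fun_prop) (by fun_prop)))]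
    refine .of_forall fun U => ?_
    rw [sum_norm_sq_mulVec, Finset.sum_eq_single 0 (fun x _ hx => by simp [hx]) (by simp)]
    simp
  phase u := by
    let D : Matrix.unitaryGroup (Bits n) ℂ := ⟨Matrix.diagonal fun x => (u x : ℂ), by
      rw [Matrix.mem_unitaryGroup_iff, Matrix.star_eq_conjTranspose,
        Matrix.diagonal_conjTranspose, Matrix.diagonal_mul_diagonal, ← Matrix.diagonal_one]
      congr 1
      funext x
      exact (Complex.mul_conj' _).trans (by rw [Circle.norm_coe, Complex.ofReal_one, one_pow])⟩
    have h := measurePreserving_mulVec_haarStates D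
    convert h using 2 with φ
    funext x
    simp [D, Matrix.mulVec_diagonal]
  perm p := by
    let P : Matrix.unitaryGroup (Bits n) ℂ := ⟨p.permMatrix ℂ, by
      rw [Matrix.mem_unitaryGroup_iff, Matrix.star_eq_conjTranspose,
        Matrix.conjTranspose_permMatrix, ← Matrix.permMatrix_mul]
      simp⟩
    have h := measurePreserving_mulVec_haarStates P
    convert h using 2 with φ
    funext x
    simp [P, Matrix.permMatrix_mulVec]

/-- The unitary `(1 + i S) / √2`, where `S` swaps the labels `x` and `y`. -/
noncomputable def swapRotation {X : Type*} [Fintype X] [DecidableEq X] (x y : X) :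
    Matrix.unitaryGroup X ℂ :=
  ⟨((Real.sqrt 2 : ℝ) : ℂ)⁻¹ • (1 + Complex.I • (Equiv.swap x y).permMatrix ℂ), by
    have hS : (Equiv.swap x y).permMatrix ℂ * (Equiv.swap x y).permMatrix ℂ = 1 := by
      rw [← Matrix.permMatrix_mul]
      simp
    have h2 : (((Real.sqrt 2 : ℝ) : ℂ)⁻¹) * (((Real.sqrt 2 : ℝ) : ℂ)⁻¹) = 2⁻¹ := by
      rw [← mul_inv, ← Complex.ofReal_mul, Real.mul_self_sqrt zero_le_two]
      simp
    rw [Matrix.mem_unitaryGroup_iff, Matrix.star_eq_conjTranspose, Matrix.conjTranspose_smul,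
      Matrix.conjTranspose_add, Matrix.conjTranspose_smul, Matrix.conjTranspose_permMatrix,
      Equiv.swap_inv, Matrix.conjTranspose_one, Matrix.smul_mul, Matrix.mul_smul, smul_smul]
    simp only [star_inv₀, Complex.star_def, Complex.conj_ofReal, Complex.conj_I, h2, add_mul,
      mul_add, one_mul, mul_one, Matrix.smul_mul, Matrix.mul_smul, smul_smul, hS]
    simp only [neg_mul, Complex.I_mul_I, neg_neg, neg_smul, one_smul]
    rw [show (1 : Matrix X X ℂ) + Complex.I • (Equiv.swap x y).permMatrix ℂ +
      (-(Complex.I • (Equiv.swap x y).permMatrix ℂ) + 1) = (2 : ℂ) • 1 by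
        rw [two_smul]; abel, smul_smul]
    norm_num⟩

theorem swapRotation_mulVec_left {X : Type*} [Fintype X] [DecidableEq X] (x y : X)
    (φ : X → ℂ) : (swapRotation x y : Matrix X X ℂ).mulVec φ x =
      ((Real.sqrt 2 : ℝ) : ℂ)⁻¹ * (φ x + Complex.I * φ y) := by
  simp [swapRotation, Matrix.smul_mulVec, Matrix.add_mulVec, Matrix.permMatrix_mulVec, mul_add]

/-- The sum of `|a + c b|⁴` over the fourth roots of unity `c`, written with `c = i c'`. -/
theorem sum_norm_add_pow_four (a b : ℂ) :
    (‖a + Complex.I * b‖ ^ 2) ^ 2 + (‖a + Complex.I * (-b)‖ ^ 2) ^ 2 +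
      (‖a + Complex.I * (Complex.I * b)‖ ^ 2) ^ 2 +
      (‖a + Complex.I * (-(Complex.I * b))‖ ^ 2) ^ 2 =
    4 * ((‖a‖ ^ 2) ^ 2 + (‖b‖ ^ 2) ^ 2 + 4 * (‖a‖ ^ 2 * ‖b‖ ^ 2)) := by
  simp only [← Complex.normSq_eq_norm_sq, Complex.normSq_apply, Complex.add_re, Complex.add_im,
    Complex.mul_re, Complex.mul_im, Complex.neg_re, Complex.neg_im, Complex.I_re, Complex.I_im]
  ring

/-- Rotating `|x⟩` into `(|x⟩ + c|y⟩)/√2` does not change the law of a Haar random state; averaging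
over the fourth roots of unity `c` relates the second moments. -/
theorem three_mul_integral_haarStates {x y : Bits n} (hxy : x ≠ y) :
    3 * ∫ φ, (‖φ x‖ ^ 2) ^ 2 ∂haarStates n =
      ∫ φ, (‖φ y‖ ^ 2) ^ 2 ∂haarStates n +
        4 * ∫ φ, ‖φ x‖ ^ 2 * ‖φ y‖ ^ 2 ∂haarStates n := by
  have hsym := isSymmetricEnsemble_haarStates n
  set a := ∫ φ, (‖φ x‖ ^ 2) ^ 2 ∂haarStates n with ha
  have hrot : ∫ φ, (‖φ x + Complex.I * φ y‖ ^ 2) ^ 2 ∂haarStates n = 4 * a := by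
    have hmp := measurePreserving_mulVec_haarStates (swapRotation x y)
    have hg : Continuous fun φ : Bits n → ℂ => (‖φ x‖ ^ 2) ^ 2 := by fun_prop
    have h := integral_map (μ := haarStates n) hmp.measurable.aemeasurable
      (f := fun φ : Bits n → ℂ => (‖φ x‖ ^ 2) ^ 2) hg.measurable.aestronglyMeasurable
    rw [hmp.map_eq] at h
    simp only [swapRotation_mulVec_left, norm_mul, norm_inv, Complex.norm_real, Real.norm_eq_abs,
      abs_of_nonneg (Real.sqrt_nonneg 2), mul_pow, inv_pow,
      Real.sq_sqrt (zero_le_two : (0 : ℝ) ≤ 2)] at h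
    rw [integral_const_mul] at h
    rw [ha, h]
    ring
  have hphase : ∀ c : Circle,
      ∫ φ, (‖φ x + Complex.I * ((c : ℂ) * φ y)‖ ^ 2) ^ 2 ∂haarStates n = 4 * a := by
    intro c
    rw [← hrot, ← hsym.integral_phase (g := fun φ : Bits n → ℂ =>
      (‖φ x + Complex.I * φ y‖ ^ 2) ^ 2) (by fun_prop) fun b => if b = y then c else 1]
    simp [hxy]
  let i : Circle := ⟨Complex.I, by simp [Submonoid.unitSphere]⟩
  have hi : (i : ℂ) = Complex.I := rfl
  have hm : Circle.exp Real.pi = (-1 : ℂ) := by simp [Circle.coe_exp]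
  have h1 := hphase (Circle.exp Real.pi)
  have h2 := hphase i
  have h3 := hphase (Circle.exp Real.pi * i)
  simp only [Circle.coe_mul, hi, hm, neg_mul, one_mul] at h1 h2 h3
  have hsum : ∫ φ, ((‖φ x + Complex.I * φ y‖ ^ 2) ^ 2 + (‖φ x + Complex.I * (-φ y)‖ ^ 2) ^ 2 +
      (‖φ x + Complex.I * (Complex.I * φ y)‖ ^ 2) ^ 2 +
      (‖φ x + Complex.I * (-(Complex.I * φ y))‖ ^ 2) ^ 2) ∂haarStates n = 16 * a := by
    rw [integral_add, integral_add, integral_add, hrot, h1, h2, h3]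
    · ring
    all_goals exact hsym.integrable_of_continuous (by fun_prop)
  simp only [sum_norm_add_pow_four] at hsum
  rw [integral_const_mul, integral_add, integral_add, integral_const_mul, ← ha] at hsum
  · linarith
  all_goals exact hsym.integrable_of_continuous (by fun_prop)

/-- Two copies of a Haar random state in dimension `d = 2ⁿ` give the same outcome with probability
`2 / (d + 1)`. -/
theorem collisionProb_haarStates (n : ℕ) :
    collisionProb (haarStates n) = 2 / (Fintype.card (Bits n) + 1) := by
  have hsym := isSymmetricEnsemble_haarStates n
  have := hsym.isProbabilityMeasure
  have hpair : ∀ x y : Bits n, 2 * ∫ φ, ‖φ x‖ ^ 2 * ‖φ y‖ ^ 2 ∂haarStates n =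
      ∫ φ, (‖φ x‖ ^ 2) ^ 2 ∂haarStates n +
        if x = y then ∫ φ, (‖φ x‖ ^ 2) ^ 2 ∂haarStates n else 0 := by
    intro x y
    split_ifs with h
    · subst h
      simp only [← sq]
      ring
    · have h1 := three_mul_integral_haarStates h
      have h2 := three_mul_integral_haarStates (Ne.symm h)
      have h3 : ∫ φ, ‖φ y‖ ^ 2 * ‖φ x‖ ^ 2 ∂haarStates n =
          ∫ φ, ‖φ x‖ ^ 2 * ‖φ y‖ ^ 2 ∂haarStates n := by simp only [mul_comm]
      linarith
  have htotal : ∑ x : Bits n, ∑ y : Bits n, ∫ φ, ‖φ x‖ ^ 2 * ‖φ y‖ ^ 2 ∂haarStates n = 1 := by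
    have h : (fun φ : Bits n → ℂ => ∑ x, ∑ y, ‖φ x‖ ^ 2 * ‖φ y‖ ^ 2) =ᵐ[haarStates n]
        fun _ => (1 : ℝ) := by
      filter_upwards [hsym.normalized] with φ hφ
      rw [← Finset.sum_mul_sum, hφ, one_mul]
    have h' := integral_congr_ae h
    rw [integral_finsetSum _ fun x _ => hsym.integrable_of_continuous (by fun_prop)] at h'
    simp only [integral_const, probReal_univ, smul_eq_mul, mul_one] at h'
    rw [← h']
    exact Finset.sum_congr rfl fun x _ =>
      (integral_finsetSum _ fun y _ => hsym.integrable_of_continuous (by fun_prop)).symm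
  have hcoll : collisionProb (haarStates n) =
      ∑ x : Bits n, ∫ φ, (‖φ x‖ ^ 2) ^ 2 ∂haarStates n :=
    integral_finsetSum _ fun x _ => hsym.integrable_of_continuous (by fun_prop)
  have h2 := congrArg (fun r => 2 * r) htotal
  simp only [Finset.mul_sum, hpair, Finset.sum_add_distrib, Finset.sum_const, Finset.card_univ,
    nsmul_eq_mul, Finset.sum_ite_eq, Finset.mem_univ, if_true] at h2
  rw [← Finset.mul_sum, ← hcoll] at h2
  rw [eq_div_iff (by positivity)]
  linarith

end Haar

/-! ### The approximate design property -/

theorem lemma4 :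
    ∃ K : ℝ, 0 < K ∧ ∀ (n t : ℕ) (ψ : EuclideanSpace ℂ (Bits n)), ‖ψ‖ = 1 →
      IsApproxStateDesign (coherenceOrbit (ψ : Bits n → ℂ)) t
        (K * (t : ℝ) ^ 2 * Real.exp (-renyiCoherenceTwo (ψ : Bits n → ℂ))) := by
  -- the coherence orbit contributes `1` and the Haar random states contribute `2`
  refine ⟨3, by norm_num, fun n t ψ hψ => ?_⟩
  have hnorm : ∑ x, ‖ψ x‖ ^ 2 = 1 := by
    rw [← EuclideanSpace.norm_sq_eq, hψ, one_pow]
  -- the smallest possible collision probability of a distribution on `d` points is `1 / d`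
  have hcs : 1 ≤ (Fintype.card (Bits n) : ℝ) * ∑ x, (‖ψ x‖ ^ 2) ^ 2 := by
    have h := sq_sum_le_card_mul_sum_sq (s := Finset.univ) (f := fun x => ‖ψ x‖ ^ 2)
    rwa [hnorm, one_pow, Finset.card_univ] at h
  have hcard : (0 : ℝ) < Fintype.card (Bits n) := by exact_mod_cast Fintype.card_pos
  have hpos : 0 < ∑ x, (‖ψ x‖ ^ 2) ^ 2 := by
    by_contra! hc
    nlinarith
  have hexp : Real.exp (-renyiCoherenceTwo (ψ : Bits n → ℂ)) = ∑ x, (‖ψ x‖ ^ 2) ^ 2 := by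
    rw [renyiCoherenceTwo, renyiEntropyTwo, neg_neg, Real.exp_log hpos]
  have hhaar : collisionProb (haarStates n) ≤ 2 * ∑ x, (‖ψ x‖ ^ 2) ^ 2 := by
    rw [collisionProb_haarStates, div_le_iff₀ (by positivity)]
    nlinarith
  refine ((isSymmetricEnsemble_coherenceOrbit hnorm).traceDist_stateMoment_le
    (isSymmetricEnsemble_haarStates n) t).trans ?_
  rw [collisionProb_coherenceOrbit hnorm, hexp]
  nlinarith [mul_le_mul_of_nonneg_left hhaar (sq_nonneg (t : ℝ))]
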